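/- Let $\mathcal X$ be a finite-dimensional real Hilbert space, and let $G=(V,E)$ be a finite connected undirected graph. Let $\nu>0$ and $\mu\ge 0$, and for every $i\in V$ let $f_i:\mathcal X\to\mathbb R$ be $\mu$-strongly convex (convex, if $\mu=0$) and $\nu$-smooth, i.e. differentiable with $\nu$-Lipschitz gradient. Assume that $\min_{x\in\mathcal X}\sum_{i\in V} f_i(x)$ is attained. Let $\widehat W\in\mathbb R^{V\times V}$ be a gossip matrix of $G$, i.e. a symmetric positive semidefinite matrix whose kernel is spanned by the all-ones vector and such that, for $i\ne j$, $\widehat W_{i,j}\neq 0$ if and only if $\{i,j\}\in E$. Let $\|\widehat W\|$ be its operator norm with respect to the Euclidean norm. Let $\gamma\in(0,2/\nu)$ and $\tau>0$ with $\tau\gamma\|\widehat W\|\le 1$. Given arbitrary $x_i^0\in\mathcal X$ and $a_i^0\in\mathcal X$ ($i\in V$) with $\sum_{i\in V}a_i^0=0$, the (deterministic) algorithm DESTROY computes, for $k=0,1,2,\dots$ and every $i\in V$, $$t_i^{k+1}=x_i^k-\gamma\nabla f_i(x_i^k),$$ $$a_i^{k+1}=(1-\tau\gamma\widehat W_{i,i})\,a_i^k+\tau\widehat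 W_{i,i}\,t_i^{k+1}+\tau\sum_{j:\{i,j\}\in E}\widehat W_{i,j}\,(t_j^{k+1}-\gamma a_j^k),$$ $$x_i^{k+1}=t_i^{k+1}-\gamma a_i^{k+1}.$$ Then there is a minimizer $x^\star$ of $\sum_{i\in V}f_i$ such that, for every $i\in V$, $x_i^k\to x^\star$ and $a_i^k\to-\nabla f_i(x^\star)$ as $k\to\infty$. -/

import Mathlib

noncomputable section

/-- A real-valued function on a Hilbert space is `ν`-smooth if it is differentiable and its gradient
is `ν`-Lipschitz continuous. -/
def IsSmoothWith {X : Type*} [NormedAddCommGroup X] [InnerProductSpace ℝ X] [CompleteSpace X]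
    (ν : ℝ) (f : X → ℝ) : Prop :=
  Differentiable ℝ f ∧ ∀ x y : X, ‖gradient f x - gradient f y‖ ≤ ν * ‖x - y‖

/-- `W` is a gossip matrix of the graph `G`: symmetric positive semidefinite, with kernel spanned by
the all-ones vector, and whose off-diagonal entries are nonzero exactly on the edges of `G`.
(On a connected graph with at least two vertices the diagonal entries are then automatically
nonzero; on a single vertex the kernel condition makes `W` zero.) -/
structure IsGossipMatrix {V : Type*} [Fintype V] [DecidableEq V] (G : SimpleGraph V)
    (W : Matrix V V ℝ) : Prop where
  posSemidef : W.PosSemidef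
  ker_eq : LinearMap.ker (Matrix.toLin' W) = Submodule.span ℝ {fun _ : V => (1 : ℝ)}
  offDiag : ∀ i j : V, i ≠ j → (W i j ≠ 0 ↔ G.Adj i j)

section Destroy

variable {X : Type*} [NormedAddCommGroup X] [InnerProductSpace ℝ X] [CompleteSpace X]
  {V : Type*} [Fintype V]

/-- The local gradient step `t_i^{k+1} = x_i^k - γ ∇f_i(x_i^k)`. -/
def destroyT (f : V → X → ℝ) (γ : ℝ) (x : V → X) (i : V) : X :=
  x i - γ • gradient (f i) (x i)

/-- The communication step, giving `a_i^{k+1}` from `(x^k, a^k)`; node `i` only uses quantities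
held by itself and by its neighbors in `G`. -/
def destroyA (G : SimpleGraph V) [DecidableRel G.Adj] (W : Matrix V V ℝ) (f : V → X → ℝ) (γ τ : ℝ)
    (x a : V → X) (i : V) : X :=
  (1 - τ * γ * W i i) • a i + (τ * W i i) • destroyT f γ x i
    + τ • ∑ j ∈ G.neighborFinset i, W i j • (destroyT f γ x j - γ • a j)

/-- The iterates `(x^k, a^k)` of (deterministic) DESTROY started at `(x0, a0)`. -/
def destroyIter (G : SimpleGraph V) [DecidableRel G.Adj] (W : Matrix V V ℝ) (f : V → X → ℝ)
    (γ τ : ℝ) (x0 a0 : V → X) : ℕ → (V → X) × (V → X)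
  | 0 => (x0, a0)
  | k + 1 =>
    let x := (destroyIter G W f γ τ x0 a0 k).1
    let a := (destroyIter G W f γ τ x0 a0 k).2
    let a' := destroyA G W f γ τ x a
    (fun i => destroyT f γ x i - γ • a' i, a')

end Destroy

end

open Filter Topology
open scoped RealInnerProductSpace

/-! ### Convexity, smoothness and cocoercive gradients -/

section Cocoercivity

variable {X : Type*} [NormedAddCommGroup X] [InnerProductSpace ℝ X] [CompleteSpace X]

/-! Stack the node variables in `PiLp 2`, let `L` be the action of the gossip matrix and `A` the
stacked gradient. The algorithm is then a primal-dual iteration for `L z = 0`, `-A z ∈ range L`: the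
kernel of `L` is consensus and its range contains the zero-sum vectors, so consensus solutions are
the minimizers. With `P` a generalized inverse of `L`, the energy `‖x - y‖² + (γ/τ)⟪P (a + A z), a +
A z⟫` decreases for every solution `y` with `A y = A z`. The decrease controls `‖A x - A z‖²` (by
Baillon–Haddad and `γ < 2/ν`) and `‖a + A z‖²`. Hence `A x → A z`, `a → -A z`, and the dual update
gives `L x → 0`. A cluster point `w` of `x` is therefore a solution; the energy centred at `w` is
monotone and vanishes along a subsequence, so `x → w` (Opial's argument). -/

lemma hasDerivAt_comp_line {f : X → ℝ} (hf : Differentiable ℝ f) (x d : X) (t : ℝ) :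
    HasDerivAt (fun s : ℝ => f (x + s • d)) ⟪gradient f (x + t • d), d⟫ t := by
  have h1 : HasDerivAt (fun s : ℝ => x + s • d) d t := by
    simpa using ((hasDerivAt_id t).smul_const d).const_add x
  have h2 := (hf (x + t • d)).hasFDerivAt.comp_hasDerivAt t h1
  rwa [← inner_gradient_left] at h2

lemma ConvexOn.add_inner_gradient_le {f : X → ℝ} (hc : ConvexOn ℝ Set.univ f)
    (hf : Differentiable ℝ f) (x y : X) : f x + ⟪gradient f x, y - x⟫ ≤ f y := by
  have hg : ConvexOn ℝ Set.univ (fun s : ℝ => f (x + s • (y - x))) := by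
    have := hc.comp_affineMap (AffineMap.lineMap x y : ℝ →ᵃ[ℝ] X)
    rw [Set.preimage_univ] at this
    convert! this using 2 with s
    simp [AffineMap.lineMap_apply, add_comm]
  have h := hg.le_slope_of_hasDerivAt (Set.mem_univ (0 : ℝ)) (Set.mem_univ (1 : ℝ)) one_pos
    (hasDerivAt_comp_line hf x (y - x) 0)
  simp only [slope_def_field, zero_smul, add_zero, one_smul, add_sub_cancel, sub_zero,
    div_one] at h
  linarith

/-- The descent lemma. -/
lemma IsSmoothWith.le_add_inner_add {ν : ℝ} {f : X → ℝ} (hf : IsSmoothWith ν f) (x d : X) :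
    f (x + d) ≤ f x + ⟪gradient f x, d⟫ + ν / 2 * ‖d‖ ^ 2 := by
  have hd : ∀ t : ℝ, HasDerivAt
      (fun s : ℝ => f (x + s • d) - s * ⟪gradient f x, d⟫ - s ^ 2 * (ν / 2 * ‖d‖ ^ 2))
      (⟪gradient f (x + t • d), d⟫ - ⟪gradient f x, d⟫ - (2 * t) * (ν / 2 * ‖d‖ ^ 2)) t := by
    intro t
    have h1 := (hasDerivAt_id t).mul_const ⟪gradient f x, d⟫
    have h2 := (hasDerivAt_pow 2 t).mul_const (ν / 2 * ‖d‖ ^ 2)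
    convert! ((hasDerivAt_comp_line hf.1 x d t).sub h1).sub h2 using 1
    simp
  have hanti := antitoneOn_of_deriv_nonpos (convex_Icc (0 : ℝ) 1)
    (fun t _ => (hd t).continuousAt.continuousWithinAt)
    (fun t _ => (hd t).differentiableAt.differentiableWithinAt) (fun t ht => by
      rw [interior_Icc] at ht
      rw [(hd t).deriv, ← inner_sub_left]
      have h1 := real_inner_le_norm (gradient f (x + t • d) - gradient f x) d
      have h2 := hf.2 (x + t • d) x
      rw [add_sub_cancel_left, norm_smul, Real.norm_of_nonneg ht.1.le] at h2
      nlinarith [mul_le_mul_of_nonneg_right h2 (norm_nonneg d)])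
  have h := hanti (Set.left_mem_Icc.2 zero_le_one) (Set.right_mem_Icc.2 zero_le_one) zero_le_one
  simp only [zero_smul, add_zero, one_smul, zero_mul, one_mul, sub_zero, one_pow, ne_eq,
    OfNat.ofNat_ne_zero, not_false_eq_true, zero_pow] at h
  linarith

lemma IsSmoothWith.norm_gradient_sub_sq_le_sub {ν : ℝ} (hν : 0 < ν) {f : X → ℝ}
    (hf : IsSmoothWith ν f) (hc : ConvexOn ℝ Set.univ f) (x y : X) :
    1 / (2 * ν) * ‖gradient f y - gradient f x‖ ^ 2 ≤ f y - f x - ⟪gradient f x, y - x⟫ := by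
  set p := gradient f y - gradient f x with hp
  -- The test point is a gradient step of length `1 / ν` from `y` for `f - ⟪gradient f x, ·⟫`, a
  -- function minimized at `x`; this length minimizes the descent bound.
  have h1 := hc.add_inner_gradient_le hf.1 x (y + (-(1 / ν)) • p)
  have h2 := hf.le_add_inner_add y ((-(1 / ν)) • p)
  have h3 : gradient f y = gradient f x + p := by simp [hp]
  rw [h3, inner_add_left, inner_smul_right, inner_smul_right, real_inner_self_eq_norm_sq,
    norm_smul, mul_pow, Real.norm_eq_abs, sq_abs] at h2
  rw [add_sub_right_comm, inner_add_right, inner_smul_right] at h1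
  have h4 : ν / 2 * ((-(1 / ν)) ^ 2 * ‖p‖ ^ 2) = 1 / (2 * ν) * ‖p‖ ^ 2 := by field_simp
  have h5 : 1 / ν * ‖p‖ ^ 2 = 2 * (1 / (2 * ν) * ‖p‖ ^ 2) := by field_simp
  linarith

/-- The Baillon–Haddad theorem: the gradient of a convex `ν`-smooth function is
`1 / ν`-cocoercive. -/
lemma IsSmoothWith.norm_gradient_sub_sq_le {ν : ℝ} (hν : 0 < ν) {f : X → ℝ}
    (hf : IsSmoothWith ν f) (hc : ConvexOn ℝ Set.univ f) (x y : X) :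
    ‖gradient f x - gradient f y‖ ^ 2 ≤ ν * ⟪gradient f x - gradient f y, x - y⟫ := by
  have h1 := hf.norm_gradient_sub_sq_le_sub hν hc x y
  have h2 := hf.norm_gradient_sub_sq_le_sub hν hc y x
  rw [norm_sub_rev] at h1
  have h3 : ⟪gradient f x, y - x⟫ = -⟪gradient f x, x - y⟫ := by
    rw [← inner_neg_right, neg_sub]
  have h4 : 1 / ν * ‖gradient f x - gradient f y‖ ^ 2 ≤ ⟪gradient f x - gradient f y, x - y⟫ := by
    have h5 : 1 / ν * ‖gradient f x - gradient f y‖ ^ 2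
      = 2 * (1 / (2 * ν) * ‖gradient f x - gradient f y‖ ^ 2) := by field_simp
    rw [inner_sub_left]
    linarith
  rwa [one_div, inv_mul_le_iff₀ hν] at h4

end Cocoercivity

/-! ### The abstract primal-dual iteration -/

section PrimalDual

variable {E : Type*} [NormedAddCommGroup E] [InnerProductSpace ℝ E]

lemma norm_gradient_step_sub_sq_le {ν γ : ℝ} (hγ : 0 < γ) (hν : 0 < ν) {A : E → E} {x z : E}
    (hA : ‖A x - A z‖ ^ 2 ≤ ν * ⟪A x - A z, x - z⟫) :
    ‖x - z - γ • (A x - A z)‖ ^ 2 ≤ ‖x - z‖ ^ 2 - γ * (2 / ν - γ) * ‖A x - A z‖ ^ 2 := by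
  rw [norm_sub_sq_real, inner_smul_right, norm_smul, mul_pow, Real.norm_eq_abs, sq_abs,
    real_inner_comm]
  have h : 2 / ν * ‖A x - A z‖ ^ 2 ≤ 2 * ⟪A x - A z, x - z⟫ := by
    rw [div_mul_eq_mul_div, div_le_iff₀ hν]; linarith
  nlinarith [mul_le_mul_of_nonneg_left h hγ.le]

/-- One step of the primal-dual iteration, written in terms of the differences to a fixed point:
`u = Δt - γ Δa`, `Δa = L b`, and `Δa⁺ = L (b + τ u)`. -/
lemma primalDual_energy_step {L : E →ₗ[ℝ] E} (hL : L.IsSymmetric) {γ τ : ℝ} (hγ : 0 < γ)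
    (hτ : 0 < τ) (hLb : ∀ v, τ * γ * ‖L v‖ ^ 2 ≤ ⟪v, L v⟫) (b u : E) :
    ‖u - (γ * τ) • L u‖ ^ 2 + γ / τ * ⟪b + τ • u, L (b + τ • u)⟫
      ≤ ‖u + γ • L b‖ ^ 2 + γ / τ * ⟪b, L b⟫ - γ ^ 2 * ‖L b‖ ^ 2 := by
  have h1 : ⟪b, L u⟫ = ⟪u, L b⟫ := by rw [← hL b u, real_inner_comm]
  have h2 : ⟪b + τ • u, L (b + τ • u)⟫ = ⟪b, L b⟫ + 2 * τ * ⟪u, L b⟫ + τ ^ 2 * ⟪u, L u⟫ := by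
    simp only [map_add, map_smul, inner_add_left, inner_add_right, inner_smul_left,
      inner_smul_right, h1, conj_trivial]
    ring
  rw [h2, norm_sub_sq_real, norm_add_sq_real, inner_smul_right, inner_smul_right, norm_smul,
    norm_smul, mul_pow, mul_pow, Real.norm_eq_abs, Real.norm_eq_abs, sq_abs, sq_abs]
  have h3 : γ / τ * (⟪b, L b⟫ + 2 * τ * ⟪u, L b⟫ + τ ^ 2 * ⟪u, L u⟫)
      = γ / τ * ⟪b, L b⟫ + 2 * γ * ⟪u, L b⟫ + γ * τ * ⟪u, L u⟫ := by field_simp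
  -- The cross terms `2γ⟪u, L b⟫` cancel; what remains is `γτ` times the bound `hLb u`.
  nlinarith [mul_le_mul_of_nonneg_left (hLb u) (mul_pos hγ hτ).le]

/-- A linear map has a linear generalized inverse. -/
lemma LinearMap.exists_comp_eq_on_range (L : E →ₗ[ℝ] E) :
    ∃ P : E →ₗ[ℝ] E, ∀ y ∈ LinearMap.range L, L (P y) = y := by
  obtain ⟨g, hg⟩ := L.rangeRestrict.exists_rightInverse_of_surjective L.range_rangeRestrict
  obtain ⟨P, hP⟩ := LinearMap.exists_extend g
  refine ⟨P, fun y hy => ?_⟩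
  have h1 : P y = g ⟨y, hy⟩ := LinearMap.congr_fun hP ⟨y, hy⟩
  rw [h1]
  exact congrArg Subtype.val (LinearMap.congr_fun hg ⟨y, hy⟩)

lemma tendsto_zero_of_antitone_sub {Φ e : ℕ → ℝ} (hΦ : ∀ k, 0 ≤ Φ k) (he : ∀ k, 0 ≤ e k)
    (h : ∀ k, Φ (k + 1) ≤ Φ k - e k) : Tendsto e atTop (𝓝 0) := by
  have hanti : Antitone Φ := antitone_nat_of_succ_le fun k => by linarith [h k, he k]
  have hlim := tendsto_atTop_ciInf hanti ⟨0, by rintro _ ⟨k, rfl⟩; exact hΦ k⟩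
  have hdiff := hlim.sub (hlim.comp (tendsto_add_atTop_nat 1))
  rw [sub_self] at hdiff
  exact squeeze_zero he (fun k => by simp only [Function.comp]; linarith [h k]) hdiff

lemma tendsto_of_mul_norm_sub_sq {E : Type*} [NormedAddCommGroup E] {u : ℕ → E} {v : E} {c : ℝ} (hc : 0 < c)
    (h : Tendsto (fun k => c * ‖u k - v‖ ^ 2) atTop (𝓝 0)) : Tendsto u atTop (𝓝 v) := by
  rw [tendsto_iff_norm_sub_tendsto_zero]
  have h1 := (h.const_mul c⁻¹).sqrt
  simpa [inv_mul_cancel_left₀ hc.ne'] using h1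

/-- Convergence of the primal-dual iteration for the inclusion `-A z ∈ range L`, `L z = 0`, with `A`
cocoercive and `L` symmetric positive semidefinite. -/
theorem primalDual_tendsto [FiniteDimensional ℝ E] {L : E →ₗ[ℝ] E} (hL : L.IsSymmetric)
    {ν γ τ : ℝ} (hν : 0 < ν) (hγ : 0 < γ) (hγν : γ < 2 / ν) (hτ : 0 < τ)
    (hLb : ∀ v, τ * γ * ‖L v‖ ^ 2 ≤ ⟪v, L v⟫) {A : E → E} (hAc : Continuous A)
    (hA : ∀ x y, ‖A x - A y‖ ^ 2 ≤ ν * ⟪A x - A y, x - y⟫) {z : E} (hLz : L z = 0)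
    (hAz : A z ∈ LinearMap.range L) {x a : ℕ → E} (ha0 : a 0 ∈ LinearMap.range L)
    (ha : ∀ k, a (k + 1) = a k + τ • L (x k - γ • A (x k) - γ • a k))
    (hx : ∀ k, x (k + 1) = x k - γ • A (x k) - γ • a (k + 1)) :
    ∃ w, L w = 0 ∧ A w = A z ∧ Tendsto x atTop (𝓝 w) ∧ Tendsto a atTop (𝓝 (-A z)) := by
  obtain ⟨P, hP⟩ := L.exists_comp_eq_on_range
  have har : ∀ k, a k ∈ LinearMap.range L := by
    intro k
    induction k with
    | zero => exact ha0
    | succ k ih =>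
      rw [ha]
      exact Submodule.add_mem _ ih (Submodule.smul_mem _ _ (LinearMap.mem_range_self L _))
  have hdr : ∀ k, a k + A z ∈ LinearMap.range L := fun k => Submodule.add_mem _ (har k) hAz
  have hQ0 : ∀ v, 0 ≤ ⟪v, L v⟫ := fun v => le_trans (by positivity) (hLb v)
  have hρ : 0 < γ * (2 / ν - γ) := mul_pos hγ (sub_pos.2 hγν)
  -- the energy relative to any `y` with `L y = 0` and `A y = A z`
  have key : ∀ y, L y = 0 → A y = A z → ∀ k,
      ‖x (k + 1) - y‖ ^ 2 + γ / τ * ⟪P (a (k + 1) + A z), a (k + 1) + A z⟫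
        ≤ ‖x k - y‖ ^ 2 + γ / τ * ⟪P (a k + A z), a k + A z⟫
          - (γ * (2 / ν - γ) * ‖A (x k) - A z‖ ^ 2 + γ ^ 2 * ‖a k - -A z‖ ^ 2) := by
    intro y hy hAy k
    set b := P (a k + A z)
    have hb : L b = a k + A z := hP _ (hdr k)
    set u := x k - y - γ • (A (x k) - A y) - γ • L b with hu
    have hLu : L u = L (x k - γ • A (x k) - γ • a k) := by
      have : u = x k - γ • A (x k) - γ • a k - y := by rw [hu, hb, hAy]; module
      rw [this, map_sub, hy, sub_zero]
    have ha' : a (k + 1) + A z = L (b + τ • u) := by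
      rw [map_add, map_smul, hLu, hb, ha]; abel
    have hx' : x (k + 1) - y = u - (γ * τ) • L u := by
      rw [hx, ha, hLu, hu, hb, hAy]; module
    -- By symmetry of `L`, `⟪v, L v⟫` depends only on `L v`, so `b + τ • u` may replace the preimage
    -- chosen by `P`.
    have hq : ⟪P (a (k + 1) + A z), a (k + 1) + A z⟫ = ⟪b + τ • u, L (b + τ • u)⟫ := by
      nth_rewrite 2 [ha']
      rw [← hL, hP _ (hdr (k + 1)), ha', hL]
    have h1 := primalDual_energy_step hL hγ hτ hLb b u
    have h2 := norm_gradient_step_sub_sq_le hγ hν (hA (x k) y)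
    have h3 : u + γ • L b = x k - y - γ • (A (x k) - A y) := by rw [hu]; abel
    rw [h3] at h1
    rw [hx', hq, sub_neg_eq_add, ← hb, ← hAy]
    linarith
  have hq0 : ∀ k, 0 ≤ γ / τ * ⟪P (a k + A z), a k + A z⟫ := fun k => by
    nth_rewrite 2 [← hP _ (hdr k)]
    exact mul_nonneg (by positivity) (hQ0 _)
  have he := tendsto_zero_of_antitone_sub
    (Φ := fun k => ‖x k - z‖ ^ 2 + γ / τ * ⟪P (a k + A z), a k + A z⟫)
    (e := fun k => γ * (2 / ν - γ) * ‖A (x k) - A z‖ ^ 2 + γ ^ 2 * ‖a k - -A z‖ ^ 2)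
    (fun k => add_nonneg (sq_nonneg _) (hq0 k)) (fun k => by positivity) (key z hLz rfl)
  have hAx : Tendsto (fun k => A (x k)) atTop (𝓝 (A z)) :=
    tendsto_of_mul_norm_sub_sq hρ (squeeze_zero (fun k => by positivity)
      (fun k => le_add_of_nonneg_right (by positivity)) he)
  have hat : Tendsto a atTop (𝓝 (-A z)) :=
    tendsto_of_mul_norm_sub_sq (sq_pos_of_pos hγ) (squeeze_zero (fun k => by positivity)
      (fun k => le_add_of_nonneg_left (by positivity)) he)
  have hLc : Continuous L := L.continuous_of_finiteDimensional
  have hPc : Continuous P := P.continuous_of_finiteDimensional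
  have hLx : Tendsto (fun k => L (x k)) atTop (𝓝 0) := by
    -- The dual update solved for `L (x k)`.
    have h1 : Tendsto (fun k => τ⁻¹ • (a (k + 1) - a k) + L (γ • (A (x k) + a k))) atTop
        (𝓝 (τ⁻¹ • (-A z - -A z) + L (γ • (A z + -A z)))) :=
      (((hat.comp (tendsto_add_atTop_nat 1)).sub hat).const_smul _).add
        ((hLc.tendsto _).comp ((hAx.add hat).const_smul γ))
    simp only [sub_self, smul_zero, add_neg_cancel, map_zero, add_zero] at h1
    refine h1.congr fun k => ?_
    rw [ha, add_sub_cancel_left, inv_smul_smul₀ hτ.ne', ← map_add]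
    congr 1
    module
  have hqt : Tendsto (fun k => γ / τ * ⟪P (a k + A z), a k + A z⟫) atTop (𝓝 0) := by
    have h1 := hat.add_const (A z)
    have h2 := (((hPc.tendsto _).comp h1).inner h1).const_mul (γ / τ)
    simpa using h2
  have hanti : ∀ y, L y = 0 → A y = A z → Antitone fun k =>
      ‖x k - y‖ ^ 2 + γ / τ * ⟪P (a k + A z), a k + A z⟫ := fun y hy hAy =>
    antitone_nat_of_succ_le fun k => (key y hy hAy k).trans (sub_le_self _ (by positivity))
  obtain ⟨w, -, φ, hφ, hw⟩ := tendsto_subseq_of_bounded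
    (Metric.isBounded_closedBall (x := z)
      (r := √(‖x 0 - z‖ ^ 2 + γ / τ * ⟪P (a 0 + A z), a 0 + A z⟫))) (x := x) fun k => by
    rw [mem_closedBall_iff_norm]
    exact Real.le_sqrt_of_sq_le
      ((le_add_of_nonneg_right (hq0 k)).trans (hanti z hLz rfl (Nat.zero_le k)))
  have hLw : L w = 0 :=
    tendsto_nhds_unique ((hLc.tendsto w).comp hw) (hLx.comp hφ.tendsto_atTop)
  have hAw : A w = A z :=
    tendsto_nhds_unique ((hAc.tendsto w).comp hw) (hAx.comp hφ.tendsto_atTop)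
  refine ⟨w, hLw, hAw, ?_, hat⟩
  have hsub : Tendsto ((fun k => ‖x k - w‖ ^ 2 + γ / τ * ⟪P (a k + A z), a k + A z⟫) ∘ φ) atTop
      (𝓝 0) := by
    have h1 := ((hw.sub_const w).norm.pow 2).add (hqt.comp hφ.tendsto_atTop)
    simpa [Function.comp_def] using h1
  have hfull := (tendsto_iff_tendsto_subseq_of_antitone (hanti w hLw hAw) hφ.tendsto_atTop).2 hsub
  refine tendsto_of_mul_norm_sub_sq one_pos (squeeze_zero (fun k => by positivity)
    (fun k => ?_) hfull)
  rw [one_mul]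
  exact le_add_of_nonneg_right (hq0 k)

end PrimalDual


/-! ### The gossip matrix acting on stacked vectors -/

section Gossip

variable {X : Type*} [NormedAddCommGroup X] [InnerProductSpace ℝ X] {V : Type*} [Fintype V]

/-- The action of a matrix on `X`-valued vectors indexed by `V`. -/
def gossipMap (W : Matrix V V ℝ) : PiLp 2 (fun _ : V => X) →ₗ[ℝ] PiLp 2 (fun _ : V => X) where
  toFun v := WithLp.toLp 2 fun i => ∑ j, W i j • v j
  map_add' v w := by ext i; simp [Finset.sum_add_distrib]
  map_smul' c v := by
    ext i
    simp only [PiLp.smul_apply, RingHom.id_apply, Finset.smul_sum]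
    exact Finset.sum_congr rfl fun j _ => smul_comm _ _ _

@[simp]
lemma gossipMap_apply (W : Matrix V V ℝ) (v : PiLp 2 (fun _ : V => X)) (i : V) :
    gossipMap W v i = ∑ j, W i j • v j := rfl

/-- The real vector of inner products of the components of `v` with `e`. -/
def innerCoord (e : X) (v : PiLp 2 (fun _ : V => X)) : EuclideanSpace ℝ V :=
  WithLp.toLp 2 fun i => ⟪e, v i⟫

omit [Fintype V] in
@[simp]
lemma innerCoord_apply (e : X) (v : PiLp 2 (fun _ : V => X)) (i : V) :
    innerCoord e v i = ⟪e, v i⟫ := rfl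

/-- Parseval: lets bounds for the scalar matrix pass to `X`-valued vectors one coordinate at a time.
-/
lemma sum_inner_innerCoord {ι : Type*} [Fintype ι] (e : OrthonormalBasis ι ℝ X)
    (v w : PiLp 2 (fun _ : V => X)) :
    ∑ c, ⟪innerCoord (e c) v, innerCoord (e c) w⟫ = ⟪v, w⟫ := by
  simp only [PiLp.inner_apply, innerCoord_apply]
  rw [Finset.sum_comm]
  refine Finset.sum_congr rfl fun i _ => ?_
  rw [← e.sum_inner_mul_inner (v i) (w i)]
  refine Finset.sum_congr rfl fun c _ => ?_
  rw [real_inner_comm (v i)]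
  simp [mul_comm]

variable [DecidableEq V]

lemma innerCoord_gossipMap (W : Matrix V V ℝ) (e : X) (v : PiLp 2 (fun _ : V => X)) :
    innerCoord e (gossipMap W v) = Matrix.toEuclideanCLM (𝕜 := ℝ) W (innerCoord e v) := by
  ext i
  simp [Matrix.mulVec, dotProduct, inner_sum, inner_smul_right]

/-- Positivity of the form at `v - s • T v` leaves a term `s² ⟪T v, T (T v)⟫`, which `s ‖T‖ ≤ 1`
bounds by `s ‖T v‖²`. -/
lemma mul_norm_toEuclideanCLM_sq_le {W : Matrix V V ℝ} (hW : W.PosSemidef) {s : ℝ} (hs : 0 < s)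
    (hsW : s * ‖Matrix.toEuclideanCLM (𝕜 := ℝ) W‖ ≤ 1) (v : EuclideanSpace ℝ V) :
    s * ‖Matrix.toEuclideanCLM (𝕜 := ℝ) W v‖ ^ 2 ≤ ⟪v, Matrix.toEuclideanCLM (𝕜 := ℝ) W v⟫ := by
  set T := Matrix.toEuclideanCLM (𝕜 := ℝ) W with hT
  have hpos : ∀ w, 0 ≤ ⟪w, T w⟫ := fun w => by
    rw [hT, Matrix.inner_toEuclideanCLM]
    simpa using hW.dotProduct_mulVec_nonneg w.ofLp
  have hsymm : ⟪v, T (T v)⟫ = ⟪T v, T v⟫ := by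
    rw [hT, Matrix.inner_toEuclideanCLM, Matrix.dotProduct_mulVec, ← Matrix.mulVec_transpose,
      ← Matrix.conjTranspose_eq_transpose_of_trivial, hW.1.eq]
    rfl
  have h1 := hpos (v - s • T v)
  simp only [map_sub, map_smul, inner_sub_left, inner_sub_right, inner_smul_left,
    inner_smul_right, hsymm, conj_trivial, real_inner_self_eq_norm_sq] at h1
  have h2 : s * ⟪T v, T (T v)⟫ ≤ ‖T v‖ ^ 2 := by
    have h3 := (real_inner_le_norm (T v) (T (T v))).trans
      (mul_le_mul_of_nonneg_left (T.le_opNorm (T v)) (norm_nonneg _))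
    nlinarith [mul_le_mul_of_nonneg_left h3 hs.le, mul_le_mul_of_nonneg_right hsW (sq_nonneg ‖T v‖)]
  nlinarith [mul_le_mul_of_nonneg_left h2 hs.le]

omit [DecidableEq V] in
lemma isSymmetric_gossipMap {W : Matrix V V ℝ} (hW : W.IsHermitian) :
    (gossipMap (X := X) W).IsSymmetric := by
  intro v w
  simp only [PiLp.inner_apply, gossipMap_apply, inner_sum, sum_inner, inner_smul_left,
    inner_smul_right, conj_trivial]
  rw [Finset.sum_comm]
  refine Finset.sum_congr rfl fun i _ => Finset.sum_congr rfl fun j _ => ?_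
  rw [← hW.apply i j, star_trivial]

lemma mul_norm_gossipMap_sq_le [FiniteDimensional ℝ X] {W : Matrix V V ℝ} (hW : W.PosSemidef)
    {s : ℝ} (hs : 0 < s) (hsW : s * ‖Matrix.toEuclideanCLM (𝕜 := ℝ) W‖ ≤ 1)
    (v : PiLp 2 (fun _ : V => X)) : s * ‖gossipMap W v‖ ^ 2 ≤ ⟪v, gossipMap W v⟫ := by
  rw [← real_inner_self_eq_norm_sq, ← sum_inner_innerCoord (stdOrthonormalBasis ℝ X),
    ← sum_inner_innerCoord (stdOrthonormalBasis ℝ X), Finset.mul_sum]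
  refine Finset.sum_le_sum fun c _ => ?_
  rw [innerCoord_gossipMap, real_inner_self_eq_norm_sq]
  exact mul_norm_toEuclideanCLM_sq_le hW hs hsW _

variable {G : SimpleGraph V} {W : Matrix V V ℝ}

lemma IsGossipMatrix.gossipMap_eq_zero_iff (hW : IsGossipMatrix G W)
    {v : PiLp 2 (fun _ : V => X)} : gossipMap W v = 0 ↔ ∀ i j, v i = v j := by
  constructor
  · intro hv i j
    refine ext_inner_left ℝ fun e => ?_
    have h1 : (fun i => ⟪e, v i⟫) ∈ LinearMap.ker (Matrix.toLin' W) := by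
      rw [LinearMap.mem_ker, Matrix.toLin'_apply]
      have h2 := innerCoord_gossipMap W e v
      rw [hv] at h2
      ext k
      have h3 := congrArg (fun u : EuclideanSpace ℝ V => u k) h2
      simpa [innerCoord, eq_comm] using h3
    rw [hW.ker_eq, Submodule.mem_span_singleton] at h1
    obtain ⟨c, hc⟩ := h1
    exact (congrFun hc i).symm.trans (congrFun hc j)
  · intro hv
    have h1 : (fun _ : V => (1 : ℝ)) ∈ LinearMap.ker (Matrix.toLin' W) := by
      rw [hW.ker_eq]; exact Submodule.mem_span_singleton_self _
    rw [LinearMap.mem_ker, Matrix.toLin'_apply] at h1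
    ext i
    have h2 := congrFun h1 i
    simp only [Matrix.mulVec, dotProduct, mul_one, Pi.zero_apply] at h2
    rw [gossipMap_apply, Finset.sum_congr rfl fun j _ => by rw [hv j i], ← Finset.sum_smul, h2,
      zero_smul]
    rfl

/-- The range of a symmetric map is the orthogonal complement of its kernel, here the constant
vectors. -/
lemma IsGossipMatrix.mem_range_gossipMap [FiniteDimensional ℝ X] (hW : IsGossipMatrix G W)
    {v : PiLp 2 (fun _ : V => X)} (hv : ∑ i, v i = 0) : v ∈ LinearMap.range (gossipMap W) := by
  rw [← Submodule.orthogonal_orthogonal (LinearMap.range (gossipMap (X := X) W)),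
    (isSymmetric_gossipMap hW.posSemidef.1).orthogonal_range, Submodule.mem_orthogonal]
  intro u hu
  rw [LinearMap.mem_ker, hW.gossipMap_eq_zero_iff] at hu
  rw [PiLp.inner_apply]
  rcases isEmpty_or_nonempty V with hV | ⟨⟨i⟩⟩
  · simp
  · rw [Finset.sum_congr rfl fun j _ => by rw [hu j i], ← inner_sum, hv, inner_zero_right]

end Gossip

/-! ### From DESTROY to the stacked iteration -/

section Iteration

variable {X : Type*} [NormedAddCommGroup X] [InnerProductSpace ℝ X] [CompleteSpace X]
  {V : Type*} [Fintype V]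

lemma isMinOn_sum_iff_sum_gradient_eq_zero {f : V → X → ℝ}
    (hc : ∀ i, ConvexOn ℝ Set.univ (f i)) (hf : ∀ i, Differentiable ℝ (f i)) (z : X) :
    (∀ y, ∑ i, f i z ≤ ∑ i, f i y) ↔ ∑ i, gradient (f i) z = 0 := by
  constructor
  · intro h
    have h1 : HasFDerivAt (fun y => ∑ i, f i y) (∑ i, fderiv ℝ (f i) z) z :=
      HasFDerivAt.fun_sum fun i _ => (hf i z).hasFDerivAt
    have h2 : IsLocalMin (fun y => ∑ i, f i y) z := Eventually.of_forall h
    have h3 := h2.hasFDerivAt_eq_zero h1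
    refine ext_inner_right ℝ fun y => ?_
    have h4 := congrArg (fun l => l y) h3
    simpa [sum_inner, inner_gradient_left] using h4
  · intro h y
    have h1 := Finset.sum_le_sum fun i (_ : i ∈ Finset.univ) =>
      (hc i).add_inner_gradient_le (hf i) z y
    rwa [Finset.sum_add_distrib, ← sum_inner, h, inner_zero_left, add_zero] at h1

/-- The stacked gradient. -/
noncomputable def stackedGradient (f : V → X → ℝ) (v : PiLp 2 (fun _ : V => X)) : PiLp 2 (fun _ : V => X) :=
  WithLp.toLp 2 fun i => gradient (f i) (v i)

omit [Fintype V] in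
@[simp]
lemma stackedGradient_apply (f : V → X → ℝ) (v : PiLp 2 (fun _ : V => X)) (i : V) :
    stackedGradient f v i = gradient (f i) (v i) := rfl

lemma IsSmoothWith.continuous_gradient {ν : ℝ} (hν : 0 < ν) {f : X → ℝ} (hf : IsSmoothWith ν f) :
    Continuous (gradient f) :=
  (LipschitzWith.of_dist_le_mul (K := ν.toNNReal) fun x y => by
    simpa only [dist_eq_norm, Real.coe_toNNReal ν hν.le] using hf.2 x y).continuous

omit [Fintype V] in
lemma continuous_stackedGradient {ν : ℝ} (hν : 0 < ν) {f : V → X → ℝ}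
    (hf : ∀ i, IsSmoothWith ν (f i)) : Continuous (stackedGradient f) :=
  (PiLp.continuous_toLp 2 _).comp <| continuous_pi fun i =>
    ((hf i).continuous_gradient hν).comp (PiLp.continuous_apply 2 _ i)

lemma norm_stackedGradient_sub_sq_le {ν : ℝ} (hν : 0 < ν) {f : V → X → ℝ}
    (hf : ∀ i, IsSmoothWith ν (f i)) (hc : ∀ i, ConvexOn ℝ Set.univ (f i))
    (v w : PiLp 2 (fun _ : V => X)) :
    ‖stackedGradient f v - stackedGradient f w‖ ^ 2
      ≤ ν * ⟪stackedGradient f v - stackedGradient f w, v - w⟫ := by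
  rw [PiLp.norm_sq_eq_of_L2, PiLp.inner_apply, Finset.mul_sum]
  exact Finset.sum_le_sum fun i _ => (hf i).norm_gradient_sub_sq_le hν (hc i) _ _

/-- Off-diagonal entries vanish outside the edges, so the neighbor sum and the diagonal terms make
up a full row of `W`. -/
lemma destroyA_eq [DecidableEq V] {G : SimpleGraph V} [DecidableRel G.Adj] {W : Matrix V V ℝ}
    (hW : IsGossipMatrix G W) (f : V → X → ℝ) (γ τ : ℝ) (x a : V → X) (i : V) :
    destroyA G W f γ τ x a i
      = a i + τ • ∑ j, W i j • (destroyT f γ x j - γ • a j) := by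
  have h : ∑ j ∈ Finset.univ.erase i, W i j • (destroyT f γ x j - γ • a j)
      = ∑ j ∈ G.neighborFinset i, W i j • (destroyT f γ x j - γ • a j) := by
    symm
    refine Finset.sum_subset (fun j hj => ?_) fun j hj hj' => ?_
    · rw [SimpleGraph.mem_neighborFinset] at hj
      exact Finset.mem_erase.2 ⟨hj.ne', Finset.mem_univ _⟩
    · rw [SimpleGraph.mem_neighborFinset,
        ← hW.offDiag i j (Finset.ne_of_mem_erase hj).symm, not_not] at hj'
      rw [hj', zero_smul]
  rw [destroyA, ← h, ← Finset.add_sum_erase _ _ (Finset.mem_univ i)]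
  module

end Iteration
theorem mainTheorem9
    {X : Type*} [NormedAddCommGroup X] [InnerProductSpace ℝ X] [FiniteDimensional ℝ X]
    [CompleteSpace X]
    {V : Type*} [Fintype V] [DecidableEq V]
    (G : SimpleGraph V) [DecidableRel G.Adj] (hG : G.Connected)
    (W : Matrix V V ℝ) (hW : IsGossipMatrix G W)
    (μ ν : ℝ) (hμ : 0 ≤ μ) (hν : 0 < ν)
    (f : V → X → ℝ)
    (hconv : ∀ i, StrongConvexOn Set.univ μ (f i))
    (hsmooth : ∀ i, IsSmoothWith ν (f i))
    (hsol : ∃ z : X, ∀ y : X, ∑ i, f i z ≤ ∑ i, f i y)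
    (γ τ : ℝ) (hγ : 0 < γ) (hγν : γ < 2 / ν) (hτ : 0 < τ)
    (hτγ : τ * γ * ‖Matrix.toEuclideanCLM (𝕜 := ℝ) W‖ ≤ 1)
    (x0 a0 : V → X) (ha0 : ∑ i, a0 i = 0) :
    ∃ xstar : X, (∀ y : X, ∑ i, f i xstar ≤ ∑ i, f i y) ∧
      ∀ i : V,
        Filter.Tendsto (fun k : ℕ => (destroyIter G W f γ τ x0 a0 k).1 i) Filter.atTop
          (nhds xstar) ∧
        Filter.Tendsto (fun k : ℕ => (destroyIter G W f γ τ x0 a0 k).2 i) Filter.atTop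
          (nhds (-gradient (f i) xstar)) := by
  have hc : ∀ i, ConvexOn ℝ Set.univ (f i) := fun i =>
    strongConvexOn_zero.1 ((hconv i).mono hμ)
  have hmin := isMinOn_sum_iff_sum_gradient_eq_zero hc fun i => (hsmooth i).1
  obtain ⟨z, hz⟩ := hsol
  set x : ℕ → PiLp 2 (fun _ : V => X) := fun k =>
    WithLp.toLp 2 (destroyIter G W f γ τ x0 a0 k).1 with hxdef
  set a : ℕ → PiLp 2 (fun _ : V => X) := fun k =>
    WithLp.toLp 2 (destroyIter G W f γ τ x0 a0 k).2 with hadef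
  have ha : ∀ k, a (k + 1) = a k
      + τ • gossipMap W (x k - γ • stackedGradient f (x k) - γ • a k) := fun k => by
    ext i
    exact destroyA_eq hW f γ τ _ _ i
  have hx : ∀ k, x (k + 1) = x k - γ • stackedGradient f (x k) - γ • a (k + 1) := fun k => rfl
  obtain ⟨w, hLw, hAw, hxw, haw⟩ := primalDual_tendsto (L := gossipMap (X := X) W)
    (isSymmetric_gossipMap hW.posSemidef.1) hν hγ hγν hτ
    (mul_norm_gossipMap_sq_le hW.posSemidef (mul_pos hτ hγ) hτγ)
    (continuous_stackedGradient hν hsmooth) (norm_stackedGradient_sub_sq_le hν hsmooth hc)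
    (z := WithLp.toLp 2 fun _ => z) (hW.gossipMap_eq_zero_iff.2 fun _ _ => rfl)
    (hW.mem_range_gossipMap ((hmin z).1 hz)) (x := x) (a := a)
    (hW.mem_range_gossipMap ha0) ha hx
  obtain ⟨i₀⟩ := hG.nonempty
  have hw : ∀ i, w i = w i₀ := fun i => hW.gossipMap_eq_zero_iff.1 hLw i i₀
  have hgw : ∀ i, gradient (f i) (w i₀) = gradient (f i) z := fun i => by
    have h := congrArg (fun u : PiLp 2 (fun _ : V => X) => u i) hAw
    simpa only [stackedGradient_apply, hw i] using h
  refine ⟨w i₀, (hmin _).2 ?_, fun i => ⟨?_, ?_⟩⟩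
  -- `A w = A z` gives equal local gradients at `w i₀` and `z`, so optimality carries over.
  · rw [Finset.sum_congr rfl fun i _ => hgw i]
    exact (hmin z).1 hz
  · rw [← hw i]
    exact ((PiLp.continuous_apply 2 _ i).tendsto w).comp hxw
  · rw [hgw i]
    exact ((PiLp.continuous_apply 2 (fun _ : V => X) i).tendsto _).comp haw
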